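/- Write $T_r(n)$ for the Turán graph, i.e. the complete $r$-partite graph on $n$ vertices whose part sizes pairwise differ by at most one. A copy of $T$ in $G$ is a (not necessarily induced) subgraph of $G$ isomorphic to $T$. (i) Let $r\ge 1$ and let $T$ be a complete balanced $r$-partite graph, i.e. a complete $r$-partite graph with non-empty parts whose sizes pairwise differ by at most one. Then there is $n_0=n_0(T)$ such that for every $n\ge n_0$ the Turán graph $T_r(n)$ is, up to isomorphism, the unique $n$-vertex $K_{r+1}$-free graph that maximizes the number of copies of $T$. (ii) Let $t\ge s\ge 1$ be integers. Then there is $n_0=n_0(s,t)$ such that for every $n\ge n_0$: the Turán graph $T_2(n)$ maximizes the number of copies of $K_{s,t}$ among all $n$-vertex triangle-free graphs if and only if $t<s+\frac12+\sqrt{2s+\frac14}$. -/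

import Mathlib

/-- Among all graphs on `n` vertices that contain no clique on `k` vertices, the `k`-clique-free
graph `G` has the largest number of (unlabelled, not necessarily induced) copies of `T`. -/
def MaximizesCopies {W : Type*} (T : SimpleGraph W) (k : ℕ) {n : ℕ}
    (G : SimpleGraph (Fin n)) : Prop :=
  G.CliqueFree k ∧
    ∀ G' : SimpleGraph (Fin n), G'.CliqueFree k → G'.copyCount T ≤ G.copyCount T

/-- `G` maximizes the number of copies of `T` among `k`-clique-free graphs on `n` vertices,
and it is the only such maximizer up to isomorphism. -/
def UniquelyMaximizesCopies {W : Type*} (T : SimpleGraph W) (k : ℕ) {n : ℕ}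
    (G : SimpleGraph (Fin n)) : Prop :=
  MaximizesCopies T k G ∧
    ∀ G' : SimpleGraph (Fin n), MaximizesCopies T k G' → Nonempty (G' ≃g G)

/-!
Why the theorem is true.

**Symmetrization.** Let `T` be complete multipartite and let `u`, `v` be non-adjacent in `G`. If
both occur in a copy of `T`, they play twin vertices of `T`; so such a copy survives when one of
them is replaced by a clone of the other. Of the two replacements, on average none loses copies
(`two_mul_labelledCopyCount_le`), hence in a graph maximizing the copies of `T` among
`K_{r+1}`-free graphs *both* replacements again give maximizers. So the maximizers are closed under
cloning vertices onto non-neighbours.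

**Maximizers are complete `r`-partite** when `T` has `r` parts. A maximizer contains an `r`-clique
`K`. If some vertex `w` missed two members of `K`, cloning would lead to a maximizer without any
`r`-clique, hence without copies of `T`
(`MaximizesLabelledCopies.eq_of_not_adj`). So every vertex misses exactly one member of `K`, and
this member is its colour (`MaximizesLabelledCopies.exists_eq_comap_top`). This gives uniqueness
already at the level of the structure; no stability argument is needed.

**Optimizing the class sizes.** In a complete `r`-partite graph with classes of sizes `N i`, the
number of labelled copies is `∑ σ, ∏ i, (N (σ i))_{a i}` with falling factorials
(`labelledCopyCount_comap_top`). Pairing `σ` with its composition with a transposition reduces the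
effect of moving a vertex between two classes to the two-class count
`bipartiteCopies s d x y = (x)_s (y)_{s+d} + (x)_{s+d} (y)_s`. Passing from the sizes `x`, `y + 1`
to `x + 1`, `y` changes it, with `X = x - s` and `Y = y - s`, by a positive multiple of
`(X + s + 1) (Y + 1) d ((X)_{d-1} - (Y)_{d-1}) - s (X - Y) ((X)_d + (Y + 1)_d)`.
For `d ≤ 1` the first term vanishes, so balancing always helps, which is the first part. For
`d ≥ 2`, the trapezoid rule for the convex function `Z ↦ (Z)_{d-2}` bounds the first term, and the
leading terms compare `d (d - 1)` with `2 s`. If `d (d - 1) < 2 s`, balancing helps whenever `n` is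
large (`bipartiteCopies_le_of_lt`). If `d (d - 1) ≥ 2 s`, the trapezoid rule is exact for the first
step away from the balanced bipartition, and that step is a strict gain, also in the case of
equality, because of the lower-order terms (`bipartiteCopies_lt_of_ge`). Finally
`t < s + 1/2 + √(2s + 1/4)` says exactly that `d (d - 1) < 2 s` for `d = t - s`.
-/

/-! ### Labelled copies and symmetrization -/

namespace SimpleGraph

open Finset Function

section Counting

lemma copyCount_congr_left {V W W' : Type*} [Fintype V] (G : SimpleGraph V) {H : SimpleGraph W}
    {H' : SimpleGraph W'} (e : H ≃g H') : G.copyCount H = G.copyCount H' := by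
  classical
  unfold copyCount
  congr 1
  ext G'
  simp only [mem_filter, mem_univ, true_and]
  exact ⟨fun ⟨f⟩ => ⟨e.symm.trans f⟩, fun ⟨f⟩ => ⟨e.trans f⟩⟩

variable {V W : Type*} [Fintype V] [Fintype W]

open Classical in
/-- Labelled copies are the unlabelled copies together with an automorphism of the pattern. -/
lemma labelledCopyCount_eq_copyCount_mul (G : SimpleGraph V) (H : SimpleGraph W) :
    G.labelledCopyCount H = G.copyCount H * Nat.card (H ≃g H) := by
  have key : ∀ G' ∈ (univ.filter fun G' : G.Subgraph => Nonempty (H ≃g G'.coe)),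
      #{f : Copy H G | f.toSubgraph = G'} = Nat.card (H ≃g H) := by
    intro G' hG'
    obtain ⟨e⟩ := (mem_filter.1 hG').2
    rw [← Fintype.card_subtype, ← Nat.card_eq_fintype_card]
    -- The copies with image `G'` form a torsor under the automorphisms of `H`.
    refine (Nat.card_congr (Equiv.ofBijective
      (fun g : H ≃g H => (⟨G'.coeCopy.comp (e.toCopy.comp g.toCopy), ?_⟩ :
        {f : Copy H G // f.toSubgraph = G'})) ⟨?_, ?_⟩)).symm
    · ext x y
      · simp only [Copy.toSubgraph, Subgraph.map_verts, Subgraph.verts_top, Set.image_univ,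
          Set.mem_range]
        constructor
        · rintro ⟨w, rfl⟩
          exact (e (g w)).2
        · intro hx
          exact ⟨g.symm (e.symm ⟨x, hx⟩), by simp [Subgraph.coeCopy]⟩
      · simp only [Copy.toSubgraph, Subgraph.map_adj, Relation.Map, Subgraph.top_adj]
        constructor
        · rintro ⟨a, b, hab, rfl, rfl⟩
          have := e.map_adj_iff.2 (g.map_adj_iff.2 hab)
          exact this
        · intro hxy
          refine ⟨g.symm (e.symm ⟨x, hxy.fst_mem⟩), g.symm (e.symm ⟨y, hxy.snd_mem⟩), ?_, ?_, ?_⟩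
          · rw [g.symm.map_adj_iff, e.symm.map_adj_iff]
            exact hxy
          · simp [Subgraph.coeCopy]
          · simp [Subgraph.coeCopy]
    · intro g g' hgg
      ext w
      have := congrArg (fun f : {f : Copy H G // f.toSubgraph = G'} => f.1 w) hgg
      exact e.injective (Subtype.ext (by simpa [Subgraph.coeCopy] using this))
    · rintro ⟨f, rfl⟩
      refine ⟨f.isoToSubgraph.trans e.symm, ?_⟩
      ext w
      simp [Subgraph.coeCopy]
      rfl
  have h1 : G.labelledCopyCount H = #(univ : Finset (Copy H G)) := by
    rw [labelledCopyCount, card_univ]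
  rw [h1, card_eq_sum_card_fiberwise (f := Copy.toSubgraph)
    (t := univ.filter fun G' : G.Subgraph => Nonempty (H ≃g G'.coe))
    (fun f _ => by simpa using ⟨f.isoToSubgraph⟩), sum_congr rfl key, sum_const, smul_eq_mul,
    copyCount]

lemma copyCount_le_copyCount_iff_labelledCopyCount (G G' : SimpleGraph V) (H : SimpleGraph W) :
    G.copyCount H ≤ G'.copyCount H ↔ G.labelledCopyCount H ≤ G'.labelledCopyCount H := by
  classical
  rw [labelledCopyCount_eq_copyCount_mul, labelledCopyCount_eq_copyCount_mul]
  have : Finite (H ≃g H) := Finite.of_injective (fun e => (e : W → W)) DFunLike.coe_injective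
  have : 0 < Nat.card (H ≃g H) := Nat.card_pos_iff.2 ⟨⟨Iso.refl⟩, this⟩
  exact (Nat.mul_le_mul_right_iff this).symm

lemma labelledCopyCount_congr_right {V' : Type*} [Fintype V'] {G : SimpleGraph V}
    {G' : SimpleGraph V'} (H : SimpleGraph W) (e : G ≃g G') :
    G.labelledCopyCount H = G'.labelledCopyCount H := by
  classical
  unfold labelledCopyCount
  refine Fintype.card_congr ⟨fun f => e.toCopy.comp f, fun f => e.symm.toCopy.comp f, ?_, ?_⟩
  · intro f; ext w; simp
  · intro f; ext w; simp

open Classical in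
/-- The injective maps that send edges of `H` to edges of `G`, as a finset of functions. -/
noncomputable def copyFinset (H : SimpleGraph W) (G : SimpleGraph V) : Finset (W → V) :=
  {f | Injective f ∧ ∀ a b, H.Adj a b → G.Adj (f a) (f b)}

lemma mem_copyFinset {H : SimpleGraph W} {G : SimpleGraph V} {f : W → V} :
    f ∈ copyFinset H G ↔ Injective f ∧ ∀ a b, H.Adj a b → G.Adj (f a) (f b) := by
  simp [copyFinset]

lemma labelledCopyCount_eq_card_copyFinset (H : SimpleGraph W) (G : SimpleGraph V) :
    G.labelledCopyCount H = #(copyFinset H G) := by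
  classical
  unfold labelledCopyCount
  rw [← card_univ]
  refine card_bij (fun f _ => (f : W → V)) ?_ ?_ ?_
  · intro f _
    exact mem_copyFinset.2 ⟨f.injective, fun a b h => f.toHom.map_adj h⟩
  · intro f _ g _ h
    exact DFunLike.coe_injective h
  · intro f hf
    obtain ⟨hi, ha⟩ := mem_copyFinset.1 hf
    exact ⟨⟨⟨f, fun h => ha _ _ h⟩, hi⟩, mem_univ _, rfl⟩

end Counting

section Cloning

variable {V W : Type*} [Fintype V] [Fintype W] [DecidableEq V]

open Classical in
/-- The graph `G.comap (update id v u)` is `G` with `v` turned into a clone of the non-neighbour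
`u`. A copy avoiding `v` or using `u` survives, because two vertices of a copy that are not
adjacent in `G` play twin vertices of `H`; a copy using `u` but not `v` also yields a second copy
in which the clone `v` replaces `u`. -/
lemma card_add_card_le_card_copyFinset_clone {H : SimpleGraph W} (hH : H.IsCompleteMultipartite)
    (G : SimpleGraph V) {u v : V} (h : ¬G.Adj u v) :
    #{f ∈ copyFinset H G | v ∈ Set.range f → u ∈ Set.range f} +
      #{f ∈ copyFinset H G | u ∈ Set.range f ∧ v ∉ Set.range f} ≤
      #(copyFinset H (G.comap (update id v u))) := by
  have hφ : ∀ x, x ≠ v → update (id : V → V) v u x = x := fun x hx => by simp [hx]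
  have hinj : Injective fun f : W → V => Equiv.swap u v ∘ f :=
    fun f g hfg => funext fun w => (Equiv.swap u v).injective (congrFun hfg w)
  rw [← card_image_of_injective {f ∈ copyFinset H G | u ∈ Set.range f ∧ v ∉ Set.range f} hinj,
    ← card_union_of_disjoint]
  · refine card_le_card fun f hf => ?_
    rw [mem_union, mem_filter, mem_image] at hf
    obtain ⟨hf, hr⟩ | ⟨g, hg, rfl⟩ := hf
    · obtain ⟨hi, ha⟩ := mem_copyFinset.1 hf
      refine mem_copyFinset.2 ⟨hi, ?_⟩
      have main : ∀ a b, H.Adj a b → f b ≠ v → G.Adj (update (id : V → V) v u (f a)) (f b) := by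
        intro a b hab hb
        by_cases hav : f a = v
        · obtain ⟨c, hc⟩ := hr ⟨a, hav⟩
          rw [hav, update_self, ← hc]
          refine ha _ _ ?_
          by_contra hcb
          have hca : ¬H.Adj a c := fun hh => h (by
            have := (ha _ _ hh).symm
            rwa [hc, hav] at this)
          exact hH.trans _ _ _ hca hcb hab
        · rw [hφ _ hav]
          exact ha _ _ hab
      intro a b hab
      rw [comap_adj]
      by_cases hb : f b = v
      · have hav : f a ≠ v := fun hav => hab.ne (hi (hav.trans hb.symm))
        rw [hφ _ hav]
        exact (main b a hab.symm hav).symm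
      · rw [hφ _ hb]
        exact main a b hab hb
    · rw [mem_filter] at hg
      obtain ⟨hg, -, hv⟩ := hg
      obtain ⟨hi, ha⟩ := mem_copyFinset.1 hg
      refine mem_copyFinset.2 ⟨(Equiv.swap u v).injective.comp hi, ?_⟩
      have main : ∀ a, update (id : V → V) v u (Equiv.swap u v (g a)) = g a := by
        intro a
        have hgv : g a ≠ v := fun hh => hv ⟨a, hh⟩
        by_cases hgu : g a = u
        · simp [hgu]
        · rw [Equiv.swap_apply_of_ne_of_ne hgu hgv, hφ _ hgv]
      intro a b hab
      simp only [comap_adj, comp_apply, main]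
      exact ha _ _ hab
  · rw [Finset.disjoint_left]
    intro f hf hf'
    obtain ⟨g, hg, rfl⟩ := mem_image.1 hf'
    obtain ⟨-, ⟨a, hau⟩, hv⟩ := mem_filter.1 hg
    obtain ⟨b, hb⟩ := (mem_filter.1 hf).2 ⟨a, by simp [hau]⟩
    refine hv ⟨b, ?_⟩
    simpa using congrArg (Equiv.swap u v) hb

/-- **Zykov symmetrization** for copies of a complete multipartite graph: of the two ways of
making two non-adjacent vertices twins, on average none loses copies. -/
lemma two_mul_labelledCopyCount_le {H : SimpleGraph W} (hH : H.IsCompleteMultipartite)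
    (G : SimpleGraph V) {u v : V} (h : ¬G.Adj u v) :
    2 * G.labelledCopyCount H ≤ (G.comap (update id v u)).labelledCopyCount H +
      (G.comap (update id u v)).labelledCopyCount H := by
  classical
  simp only [labelledCopyCount_eq_card_copyFinset]
  have h1 := card_add_card_le_card_copyFinset_clone hH G h
  have h2 := card_add_card_le_card_copyFinset_clone hH G (fun h' => h h'.symm)
  have h3 := card_filter_add_card_filter_not (s := copyFinset H G)
    (fun f => v ∈ Set.range f → u ∈ Set.range f)
  have h4 := card_filter_add_card_filter_not (s := copyFinset H G)
    (fun f => u ∈ Set.range f → v ∈ Set.range f)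
  simp only [Classical.not_imp] at h3 h4
  omega

end Cloning

end SimpleGraph

/-! ### Maximizers are complete `r`-partite -/

namespace SimpleGraph

open Finset Function

section Structure

lemma CliqueFree.comap_fun {U V : Type*} {G : SimpleGraph V} {k : ℕ} (h : G.CliqueFree k)
    (φ : U → V) : (G.comap φ).CliqueFree k := by
  classical
  intro s hs
  refine h (s.image φ) ⟨?_, ?_⟩
  · intro x hx y hy hxy
    obtain ⟨a, ha, rfl⟩ := mem_image.1 hx
    obtain ⟨b, hb, rfl⟩ := mem_image.1 hy
    exact hs.isClique ha hb (fun hab => hxy (hab ▸ rfl))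
  · rw [card_image_of_injOn, hs.card_eq]
    intro a ha b hb hab
    by_contra hne
    have := hs.isClique ha hb hne
    rw [comap_adj, hab] at this
    exact G.irrefl this

variable {V W : Type*} [Fintype V] [Fintype W]

/-- `G` has the most labelled copies of `H` among the `k`-clique-free graphs on its vertex set. -/
def MaximizesLabelledCopies (H : SimpleGraph W) (k : ℕ) (G : SimpleGraph V) : Prop :=
  G.CliqueFree k ∧
    ∀ G' : SimpleGraph V, G'.CliqueFree k → G'.labelledCopyCount H ≤ G.labelledCopyCount H

lemma maximizesCopies_iff {n k : ℕ} {H : SimpleGraph W} {G : SimpleGraph (Fin n)} :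
    MaximizesCopies H k G ↔ MaximizesLabelledCopies H k G := by
  simp only [MaximizesCopies, MaximizesLabelledCopies,
    copyCount_le_copyCount_iff_labelledCopyCount]

lemma exists_maximizesLabelledCopies (H : SimpleGraph W) {k : ℕ} {G₀ : SimpleGraph V}
    (h₀ : G₀.CliqueFree k) : ∃ G : SimpleGraph V, MaximizesLabelledCopies H k G := by
  classical
  obtain ⟨G, hG, hmax⟩ := Set.exists_max_image {G : SimpleGraph V | G.CliqueFree k}
    (fun G => G.labelledCopyCount H) (Set.toFinite _) ⟨G₀, h₀⟩
  exact ⟨G, hG, hmax⟩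

variable {H : SimpleGraph W} {G : SimpleGraph V} {k r : ℕ}

lemma MaximizesLabelledCopies.not_cliqueFree (hr : ¬H.CliqueFree r)
    (hG : MaximizesLabelledCopies H k G) {G₀ : SimpleGraph V} (h₀ : G₀.CliqueFree k)
    (hHG₀ : H ⊑ G₀) : ¬G.CliqueFree r := by
  have h1 : 0 < G.labelledCopyCount H :=
    (labelledCopyCount_pos.2 hHG₀).trans_le (hG.2 _ h₀)
  exact fun h => hr (h.comap (labelledCopyCount_pos.1 h1))

variable [DecidableEq V]

lemma MaximizesLabelledCopies.clone (hH : H.IsCompleteMultipartite)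
    (hG : MaximizesLabelledCopies H k G) {u v : V} (h : ¬G.Adj u v) :
    MaximizesLabelledCopies H k (G.comap (update id v u)) := by
  refine ⟨hG.1.comap_fun _, fun G' hG' => (hG.2 G' hG').trans ?_⟩
  have h1 := two_mul_labelledCopyCount_le hH G h
  have h2 := hG.2 _ (hG.1.comap_fun (update id u v))
  omega

/-- Cloning several vertices, one after the other, onto fixed non-neighbours. -/
lemma MaximizesLabelledCopies.comap_idempotent (hH : H.IsCompleteMultipartite)
    (hG : MaximizesLabelledCopies H k G) (φ : V → V) (hφ : ∀ x, φ (φ x) = φ x)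
    (h : ∀ x, ¬G.Adj (φ x) x) : MaximizesLabelledCopies H k (G.comap φ) := by
  have key : ∀ S : Finset V,
      MaximizesLabelledCopies H k (G.comap fun x => if x ∈ S then φ x else x) := by
    intro S
    induction S using Finset.induction_on with
    | empty =>
      have h0 : G.comap (fun x => x) = G := comap_id
      simpa [h0] using hG
    | insert x S hx ih =>
      have := ih.clone hH (u := φ x) (v := x) (by simp [hx, hφ, h])
      convert this using 1
      ext a b
      have aux : ∀ y, (if y ∈ insert x S then φ y else y) =
          if update (id : V → V) x (φ x) y ∈ S then φ (update (id : V → V) x (φ x) y)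
            else update (id : V → V) x (φ x) y := by
        intro y
        by_cases hy : y = x
        · subst hy; simp [hφ]
        · simp [hy]
      simp only [comap_adj, aux]
  simpa using key univ

/-- In a maximizer, a vertex misses at most one vertex of an `r`-clique `K`. Otherwise `w` misses
two vertices `i, j` of `K`. Turn all other vertices into clones of members of `K`, and then the
class of `i` into clones of `w`: the result is still a maximizer, but it is `(r - 1)`-colourable,
`w` sharing its colour with `j`, hence contains no copy of `H`. -/
lemma MaximizesLabelledCopies.eq_of_not_adj (hH : H.IsCompleteMultipartite)
    (hr : ¬H.CliqueFree r) (hG : MaximizesLabelledCopies H (r + 1) G)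
    {G₀ : SimpleGraph V} (h₀ : G₀.CliqueFree (r + 1)) (hHG₀ : H ⊑ G₀)
    {K : Finset V} (hK : G.IsNClique r K) {w i j : V} (hi : i ∈ K) (hj : j ∈ K)
    (hwi : ¬G.Adj w i) (hwj : ¬G.Adj w j) : i = j := by
  by_contra hij
  have hne : ∀ x ∈ K, ∀ y ∈ K, ¬G.Adj x y → x = y := fun x hx y hy h => by
    by_contra hxy
    exact h (hK.isClique hx hy hxy)
  have hwK : w ∉ K := fun hw => hij ((hne w hw i hi hwi).symm.trans (hne w hw j hj hwj))
  have hmiss : ∀ x, ∃ y ∈ K, ¬G.Adj y x := by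
    intro x
    by_contra! hx
    have hxK : x ∉ K := fun hxK => G.irrefl (hx x hxK)
    exact hG.1 _ (hK.insert fun b hb => (hx b hb).symm)
  choose p hpK hp using hmiss
  have hpid : ∀ x ∈ K, p x = x := fun x hx => hne _ (hpK x) _ hx (hp x)
  let φ : V → V := fun x => if x = w then w else p x
  have hφw : φ w = w := by simp [φ]
  have hφK : ∀ x ∈ K, φ x = x := fun x hx => by
    have : x ≠ w := fun h => hwK (h ▸ hx)
    simp [φ, this, hpid x hx]
  have hφmem : ∀ x, x ≠ w → φ x ∈ K := fun x hx => by simp [φ, hx, hpK]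
  have hG1 : MaximizesLabelledCopies H (r + 1) (G.comap φ) := by
    refine hG.comap_idempotent hH φ (fun x => ?_) fun x => ?_
    · by_cases hx : x = w
      · rw [hx, hφw, hφw]
      · exact hφK _ (hφmem x hx)
    · by_cases hx : x = w
      · rw [hx, hφw]; exact G.irrefl
      · simp only [φ, hx, if_false]; exact hp x
  let ψ : V → V := fun x => if φ x = i then w else x
  have hψw : ψ w = w := by simp [ψ]
  have hG2 : MaximizesLabelledCopies H (r + 1) ((G.comap φ).comap ψ) := by
    refine hG1.comap_idempotent hH ψ (fun x => ?_) fun x => ?_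
    · by_cases hx : φ x = i
      · simp [ψ, hx]
      · simp [ψ, hx]
    · by_cases hx : φ x = i
      · simp [ψ, hx, hφw, hwi]
      · simp [ψ, hx]
  refine hG2.not_cliqueFree hr h₀ hHG₀ fun Q hQ => ?_
  -- `φ ∘ ψ` maps into `K` with `i` replaced by `w`; recolour `w` by `j`.
  let c : V → V := fun x => if φ (ψ x) = w then j else φ (ψ x)
  have hcK : ∀ x, c x ∈ K.erase i := by
    intro x
    by_cases hx : φ (ψ x) = w
    · simp [c, hx, hj, Ne.symm hij]
    · have h1 : ψ x ≠ w := fun h => hx (by rw [h, hφw])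
      have h2 : φ x ≠ i := fun h => h1 (by simp [ψ, h])
      have h3 : ψ x = x := by simp [ψ, h2]
      rw [h3] at h1 hx
      simp [c, h3, hx, h2, hφmem x h1]
  have hcadj : ∀ x y, G.Adj (φ (ψ x)) (φ (ψ y)) → c x ≠ c y := by
    intro x y hxy hc
    by_cases hx : φ (ψ x) = w <;> by_cases hy : φ (ψ y) = w
    · rw [hx, hy] at hxy; exact G.irrefl hxy
    · simp only [c, hx, hy, if_true, if_false] at hc
      rw [hx, ← hc] at hxy; exact hwj hxy
    · simp only [c, hx, hy, if_true, if_false] at hc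
      rw [hy, hc] at hxy; exact hwj hxy.symm
    · simp only [c, hx, hy, if_false] at hc
      rw [hc] at hxy; exact G.irrefl hxy
  have hcard := card_le_card_of_injOn (s := Q) (t := K.erase i) c (fun x _ => hcK x) (by
    intro x hx y hy hxy
    by_contra hne'
    exact hcadj x y (hQ.isClique hx hy hne') hxy)
  rw [hQ.card_eq, card_erase_of_mem hi, hK.card_eq] at hcard
  have : 0 < #K := card_pos.2 ⟨i, hi⟩
  rw [hK.card_eq] at this
  omega

/-- Maximizers are complete `r`-partite: the colour of a vertex is the unique member of a fixed
`r`-clique that it misses. -/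
lemma MaximizesLabelledCopies.exists_eq_comap_top (hH : H.IsCompleteMultipartite)
    (hr : ¬H.CliqueFree r) (hG : MaximizesLabelledCopies H (r + 1) G)
    {G₀ : SimpleGraph V} (h₀ : G₀.CliqueFree (r + 1)) (hHG₀ : H ⊑ G₀) :
    ∃ c : V → Fin r, Surjective c ∧ G = (⊤ : SimpleGraph (Fin r)).comap c := by
  obtain ⟨K, hK⟩ : ∃ K, G.IsNClique r K := by
    simpa [CliqueFree] using hG.not_cliqueFree hr h₀ hHG₀
  have uniq : ∀ {K : Finset V}, G.IsNClique r K → ∀ {w i j : V}, i ∈ K → j ∈ K →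
      ¬G.Adj w i → ¬G.Adj w j → i = j :=
    fun hK _ _ _ hi hj => hG.eq_of_not_adj hH hr h₀ hHG₀ hK hi hj
  have hmiss : ∀ x, ∃ y ∈ K, ¬G.Adj x y := by
    intro x
    by_contra! hx
    exact hG.1 _ (hK.insert hx)
  choose p hpK hp using hmiss
  have hpid : ∀ x ∈ K, p x = x := fun x hx => uniq hK (hpK x) hx (hp x) G.irrefl
  have hpadj : ∀ x, ∀ y ∈ K, y ≠ p x → G.Adj x y := fun x y hy hne => by
    by_contra h
    exact hne (uniq hK hy (hpK x) h (hp x))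
  -- Exchanging a vertex for its missed vertex gives another `r`-clique.
  have hswap : ∀ x, G.IsNClique r (insert x (K.erase (p x))) := by
    intro x
    have hpos : 0 < #K := card_pos.2 ⟨_, hpK x⟩
    have hKe : G.IsNClique (r - 1) (K.erase (p x)) :=
      ⟨hK.isClique.subset (erase_subset _ _), by rw [card_erase_of_mem (hpK x), hK.card_eq]⟩
    have := hKe.insert (a := x) fun b hb => hpadj x b (mem_of_mem_erase hb) (ne_of_mem_erase hb)
    rwa [Nat.sub_add_cancel (by rw [hK.card_eq] at hpos; omega)] at this
  have hadj : ∀ x y, G.Adj x y ↔ p x ≠ p y := by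
    intro x y
    constructor
    · intro hxy hpxy
      refine hG.1 _ ((hswap x).insert (a := y) fun b hb => ?_)
      obtain rfl | hb := mem_insert.1 hb
      · exact hxy.symm
      · exact hpadj y b (mem_of_mem_erase hb) (hpxy ▸ ne_of_mem_erase hb)
    · intro hne
      by_contra hxy
      have h1 := uniq (hswap x) (w := y) (i := x) (j := p y) (mem_insert_self _ _)
        (mem_insert_of_mem (mem_erase.2 ⟨hne.symm, hpK y⟩)) (fun h => hxy h.symm) (hp y)
      apply hne
      conv_lhs => rw [h1]
      exact hpid _ (hpK y)
  have e : K ≃ Fin r := K.equivFinOfCardEq hK.card_eq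
  refine ⟨fun x => e ⟨p x, hpK x⟩, fun i => ⟨e.symm i, ?_⟩, ?_⟩
  · have : (⟨p (e.symm i), hpK _⟩ : K) = e.symm i := Subtype.ext (hpid _ (e.symm i).2)
    simp [this]
  · ext x y
    simp [hadj]

end Structure

end SimpleGraph

/-! ### Copies in complete multipartite graphs -/

namespace SimpleGraph

open Finset Function

section CompleteMultipartiteCount

variable {V : Type*} [Fintype V] {r : ℕ} {a : Fin r → ℕ}

/-- A copy of a complete `r`-partite graph in a complete `r`-partite graph maps every part into
one part: the colours seen by different parts are disjoint and non-empty, so each part sees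
exactly one of the `r` colours. -/
lemma exists_perm_of_mem_copyFinset (ha : ∀ i, 1 ≤ a i) (c : V → Fin r)
    {f : (Σ i : Fin r, Fin (a i)) → V}
    (hf : f ∈ copyFinset (completeMultipartiteGraph fun i => Fin (a i))
      ((⊤ : SimpleGraph (Fin r)).comap c)) :
    ∃ σ : Equiv.Perm (Fin r), ∀ x, c (f x) = σ x.1 := by
  obtain ⟨-, hadj⟩ := mem_copyFinset.1 hf
  have hne : ∀ x y : (Σ i : Fin r, Fin (a i)), x.1 ≠ y.1 → c (f x) ≠ c (f y) :=
    fun x y hxy => hadj x y hxy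
  let p : (i : Fin r) → (Σ i : Fin r, Fin (a i)) := fun i => ⟨i, ⟨0, ha i⟩⟩
  have hinj : Injective fun i => c (f (p i)) := fun i j hij => by
    by_contra h
    exact hne (p i) (p j) h hij
  have hbij := Finite.injective_iff_bijective.1 hinj
  refine ⟨Equiv.ofBijective _ hbij, fun x => ?_⟩
  obtain ⟨j, hj⟩ := hbij.2 (c (f x))
  have hxj : x.1 = j := by
    by_contra h
    exact hne x (p j) h hj.symm
  rw [hxj]
  exact hj.symm

open Classical in
lemma card_filter_injective_color (a : Fin r → ℕ) (c : V → Fin r) (σ : Fin r → Fin r)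
    (hσ : Injective σ) :
    #{f : (Σ i : Fin r, Fin (a i)) → V | Injective f ∧ ∀ x, c (f x) = σ x.1} =
      ∏ i, (#{v | c v = σ i}).descFactorial (a i) := by
  have h1 : ∀ i, (#{v | c v = σ i}).descFactorial (a i) =
      Fintype.card (Fin (a i) ↪ {v // c v = σ i}) := by
    intro i
    rw [Fintype.card_embedding_eq, Fintype.card_fin, Fintype.card_subtype]
  simp only [h1]
  rw [← Fintype.card_pi, ← Fintype.card_subtype]
  refine Fintype.card_congr
    { toFun := fun f i => ⟨fun k => ⟨f.1 ⟨i, k⟩, f.2.2 _⟩, fun k l hkl => by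
        have := f.2.1 (Subtype.ext_iff.1 hkl)
        simpa using this⟩
      invFun := fun g => ⟨fun x => (g x.1 x.2).1, ?_, fun x => (g x.1 x.2).2⟩
      left_inv := fun f => rfl
      right_inv := fun g => rfl }
  rintro ⟨i, k⟩ ⟨j, l⟩ hkl
  have hij : i = j := hσ (by
    rw [← (g i k).2, ← (g j l).2]
    exact congrArg c hkl)
  subst hij
  have hkl' : k = l := (g i).injective (Subtype.ext hkl)
  rw [hkl']

open Classical in
/-- The number of labelled copies of the complete `r`-partite graph with part sizes `a i` in the
complete `r`-partite graph with colour classes `c ⁻¹' {i}`: choose which part goes to which class,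
then embed each part. -/
lemma labelledCopyCount_comap_top (ha : ∀ i, 1 ≤ a i) (c : V → Fin r) :
    ((⊤ : SimpleGraph (Fin r)).comap c).labelledCopyCount
        (completeMultipartiteGraph fun i => Fin (a i)) =
      ∑ σ : Equiv.Perm (Fin r), ∏ i, (#{v | c v = σ i}).descFactorial (a i) := by
  have h2 : copyFinset (completeMultipartiteGraph fun i => Fin (a i))
      ((⊤ : SimpleGraph (Fin r)).comap c) = univ.biUnion fun σ : Equiv.Perm (Fin r) =>
        {f : (Σ i : Fin r, Fin (a i)) → V | Injective f ∧ ∀ x, c (f x) = σ x.1} := by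
    ext f
    simp only [mem_biUnion, mem_univ, true_and, mem_filter]
    constructor
    · intro hf
      obtain ⟨σ, hσ⟩ := exists_perm_of_mem_copyFinset ha c hf
      exact ⟨σ, (mem_copyFinset.1 hf).1, hσ⟩
    · rintro ⟨σ, hi, hσ⟩
      refine mem_copyFinset.2 ⟨hi, fun x y hxy => ?_⟩
      simp only [comap_adj, top_adj, hσ]
      exact fun h => hxy (σ.injective h)
  rw [labelledCopyCount_eq_card_copyFinset, h2, card_biUnion]
  · exact sum_congr rfl fun σ _ => card_filter_injective_color a c σ σ.injective
  · intro σ _ τ _ hστ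
    rw [Function.onFun, Finset.disjoint_left]
    intro f hf hf'
    simp only [mem_filter, mem_univ, true_and] at hf hf'
    refine hστ (Equiv.ext fun i => ?_)
    rw [← hf.2 ⟨i, ⟨0, ha i⟩⟩, ← hf'.2 ⟨i, ⟨0, ha i⟩⟩]

lemma completeMultipartiteGraph_not_cliqueFree (ha : ∀ i, 1 ≤ a i) :
    ¬(completeMultipartiteGraph fun i : Fin r => Fin (a i)).CliqueFree r := by
  classical
  refine IsNClique.not_cliqueFree (s := univ.image fun i : Fin r => ⟨i, ⟨0, ha i⟩⟩) ⟨?_, ?_⟩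
  · intro x hx y hy hxy
    obtain ⟨i, -, rfl⟩ := mem_image.1 hx
    obtain ⟨j, -, rfl⟩ := mem_image.1 hy
    exact fun h => hxy (by
      have : i = j := h
      subst this
      rfl)
  · rw [card_image_of_injective, card_univ, Fintype.card_fin]
    exact fun i j hij => congrArg Sigma.fst hij

lemma comap_top_cliqueFree {U : Type*} (c : U → Fin r) :
    ((⊤ : SimpleGraph (Fin r)).comap c).CliqueFree (r + 1) :=
  CliqueFree.comap_fun (cliqueFree_of_card_lt (by simp)) c

/-- On sufficiently many vertices there is a complete `r`-partite graph containing the given one: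
a blow-up along a surjection. -/
lemma exists_comap_top_isContained (hcard : ∑ i, a i ≤ Fintype.card V) (hr : 1 ≤ r) :
    ∃ c : V → Fin r, (completeMultipartiteGraph fun i => Fin (a i)) ⊑
      (⊤ : SimpleGraph (Fin r)).comap c := by
  classical
  obtain ⟨e⟩ : Nonempty ((Σ i : Fin r, Fin (a i)) ↪ V) :=
    Function.Embedding.nonempty_of_card_le (by simpa using hcard)
  refine ⟨fun v => if h : ∃ x, e x = v then h.choose.1 else ⟨0, hr⟩,
    ⟨⟨⟨e, fun {x y} hxy => ?_⟩, e.injective⟩⟩⟩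
  have key : ∀ x, (if h : ∃ x', e x' = e x then h.choose.1 else (⟨0, hr⟩ : Fin r)) = x.1 := by
    intro x
    have h : ∃ x', e x' = e x := ⟨x, rfl⟩
    rw [dif_pos h, e.injective h.choose_spec]
  simp only [comap_adj, top_adj, key]
  exact hxy

end CompleteMultipartiteCount

end SimpleGraph

/-! ### Two classes: falling factorials -/

section FallingFactorials

/-- The falling factorial's recursion over the integers, where no truncation occurs: if `X < k`,
both sides vanish. -/
lemma Nat.cast_descFactorial_succ_int (X k : ℕ) :
    ((X.descFactorial (k + 1) : ℕ) : ℤ) = ((X : ℤ) - k) * X.descFactorial k := by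
  rw [Nat.descFactorial_succ]
  obtain h | h := le_or_gt k X
  · push_cast [h]; ring
  · rw [Nat.descFactorial_eq_zero_iff_lt.2 h]; simp

lemma Nat.succ_descFactorial_succ_sub (X k : ℕ) :
    (((X + 1).descFactorial (k + 1) : ℕ) : ℤ) - X.descFactorial (k + 1) =
      (k + 1) * X.descFactorial k := by
  rw [Nat.cast_descFactorial_succ_int X k, Nat.succ_descFactorial_succ]
  push_cast; ring

/-- Discrete convexity of falling factorials: the last increment is the largest. -/
lemma Nat.descFactorial_sub_le (e Y m : ℕ) :
    (((Y + m + 1).descFactorial e : ℕ) : ℤ) - Y.descFactorial e ≤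
      (m + 1) * (((Y + m + 1).descFactorial e : ℕ) - ((Y + m).descFactorial e : ℕ)) := by
  obtain _ | e := e
  · simp
  induction m with
  | zero => simp
  | succ m ih =>
    have h1 := Nat.succ_descFactorial_succ_sub (Y + m) e
    have h2 := Nat.succ_descFactorial_succ_sub (Y + m + 1) e
    have h3 : (((Y + m).descFactorial e : ℕ) : ℤ) ≤ (Y + m + 1).descFactorial e := by
      exact_mod_cast Nat.descFactorial_le e (Nat.le_succ _)
    have h4 : (0 : ℤ) ≤ ((m : ℤ) + 1) * (e + 1) := by positivity
    have h5 := mul_le_mul_of_nonneg_left h3 h4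
    rw [← add_assoc Y m 1]
    push_cast
    rw [h1] at ih
    rw [h2]
    nlinarith

/-- The trapezoid rule overestimates the sum of the convex function `Z ↦ (Z)ₑ`. -/
lemma Nat.descFactorial_trapezoid (e Y k : ℕ) :
    2 * ((((Y + k + 1).descFactorial (e + 1) : ℕ) : ℤ) - Y.descFactorial (e + 1)) ≤
      (e + 1) * (k + 1) * (((Y + k).descFactorial e : ℕ) + (Y.descFactorial e : ℕ)) := by
  induction k with
  | zero =>
    have := Nat.succ_descFactorial_succ_sub Y e
    simp only [add_zero, Nat.cast_zero, zero_add]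
    rw [this]
    linarith
  | succ k ih =>
    have h1 := Nat.succ_descFactorial_succ_sub (Y + k + 1) e
    have h2 := Nat.descFactorial_sub_le e Y k
    have h3 := mul_le_mul_of_nonneg_left h2 (by positivity : (0 : ℤ) ≤ e + 1)
    rw [← add_assoc Y k 1]
    push_cast
    nlinarith

end FallingFactorials

namespace SimpleGraph

section TwoParts

/-- The number of labelled copies of `K_{s,s+d}` in the complete bipartite graph `K_{x,y}`. -/
def bipartiteCopies (s d x y : ℕ) : ℕ :=
  x.descFactorial s * y.descFactorial (s + d) + x.descFactorial (s + d) * y.descFactorial s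

lemma bipartiteCopies_comm (s d x y : ℕ) : bipartiteCopies s d x y = bipartiteCopies s d y x := by
  unfold bipartiteCopies; ring

lemma bipartiteCopies_eq (s d X Y : ℕ) : bipartiteCopies s d (X + s) (Y + s) =
    (X + s).descFactorial s * (Y + s).descFactorial s *
      (X.descFactorial d + Y.descFactorial d) := by
  have h : ∀ Z : ℕ, (Z + s).descFactorial (s + d) =
      Z.descFactorial d * (Z + s).descFactorial s := by
    intro Z
    have := Nat.descFactorial_mul_descFactorial (n := Z + s) (k := s) (m := s + d) (by omega)
    simpa using this.symm
  unfold bipartiteCopies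
  rw [h, h]; ring

/-- The effect of moving one vertex from the class of size `y` to the class of size `x`, with
`X = x - s` and `Y = y - 1 - s`, up to positive factors. -/
lemma bipartiteCopies_step (s d X Y : ℕ) : ∃ p q : ℤ, 0 < p ∧ 0 < q ∧
    p * (bipartiteCopies s d (X + 1 + s) (Y + s) - bipartiteCopies s d (X + s) (Y + 1 + s)) =
      q * (((X : ℤ) + s + 1) * (Y + 1) * ((X + 1).descFactorial d + Y.descFactorial d) -
          (X + 1) * (Y + s + 1) * (X.descFactorial d + (Y + 1).descFactorial d)) := by
  refine ⟨((X : ℤ) + 1) * (Y + s + 1),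
    (X + s).descFactorial s * (Y + 1 + s).descFactorial s, by positivity, ?_, ?_⟩
  · have hP : 0 < (X + s).descFactorial s * (Y + 1 + s).descFactorial s :=
      Nat.mul_pos (Nat.descFactorial_pos.2 (by omega)) (Nat.descFactorial_pos.2 (by omega))
    exact_mod_cast hP
  have h : ∀ Z : ℕ, ((Z : ℤ) + 1) * (Z + 1 + s).descFactorial s =
      (Z + s + 1) * (Z + s).descFactorial s := by
    intro Z
    have h1 := Nat.cast_descFactorial_succ_int (Z + 1 + s) s
    have h2 := Nat.succ_descFactorial_succ (Z + s) s
    rw [show Z + s + 1 = Z + 1 + s by ring] at h2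
    rw [h2] at h1
    push_cast at h1
    linear_combination -h1
  rw [bipartiteCopies_eq, bipartiteCopies_eq]
  push_cast
  linear_combination
    (Y + s + 1) * (Y + s).descFactorial s * ((X + 1).descFactorial d + Y.descFactorial d : ℤ) * h X
     - (X + s + 1) * (X + s).descFactorial s *
       ((X + 1).descFactorial d + Y.descFactorial d : ℤ) * h Y

/-- With part sizes differing by at most one, balancing strictly increases the number of copies. -/
lemma bipartiteCopies_lt_of_le_one {s d x y : ℕ} (hs : 1 ≤ s) (hd : d ≤ 1) (hxy : y + 1 ≤ x)
    (hpos : 0 < bipartiteCopies s d (x + 1) y) :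
    bipartiteCopies s d (x + 1) y < bipartiteCopies s d x (y + 1) := by
  have hys : s ≤ y := by
    by_contra! h
    have h1 : y.descFactorial s = 0 := Nat.descFactorial_eq_zero_iff_lt.2 h
    have h2 : y.descFactorial (s + d) = 0 := Nat.descFactorial_eq_zero_iff_lt.2 (by omega)
    simp [bipartiteCopies, h1, h2] at hpos
  obtain ⟨Y, rfl⟩ := Nat.exists_eq_add_of_le' hys
  obtain ⟨X, rfl⟩ := Nat.exists_eq_add_of_le' (show s ≤ x by omega)
  have hXY : (Y : ℤ) < X := by exact_mod_cast (by omega : Y < X)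
  have hs' : (1 : ℤ) ≤ s := by exact_mod_cast hs
  have hneg : ((X : ℤ) + s + 1) * (Y + 1) * ((X + 1).descFactorial d + Y.descFactorial d) -
          (X + 1) * (Y + s + 1) * (X.descFactorial d + (Y + 1).descFactorial d) < 0 := by
    have h1 : (0 : ℤ) < s * (X - Y) := by nlinarith
    have hY : (0 : ℤ) ≤ Y := by positivity
    obtain rfl | rfl : d = 0 ∨ d = 1 := by omega
    · simp only [Nat.descFactorial_zero, Nat.cast_one]
      nlinarith
    · simp only [Nat.descFactorial_one, Nat.cast_add, Nat.cast_one]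
      nlinarith
  obtain ⟨p, q, hp, hq, hpq⟩ := bipartiteCopies_step s d X Y
  have h2 := mul_neg_of_pos_of_neg hq hneg
  rw [← hpq] at h2
  have h4 := neg_of_mul_neg_right h2 hp.le
  rw [show X + s + 1 = X + 1 + s by ring, show Y + s + 1 = Y + 1 + s by ring]
  exact_mod_cast (by linarith : (bipartiteCopies s d (X + 1 + s) (Y + s) : ℤ) <
    bipartiteCopies s d (X + s) (Y + 1 + s))

/-- The quadratic inequality behind the asymptotic optimality of the balanced bipartition:
`d (d - 1) < 2 s` with `d = e + 2` beats the lower-order terms once `Z` is large. Both sides are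
linear in `A` and `B`, so it suffices to compare the coefficients of `A - B` and `B`. -/
lemma quadratic_bound {s e Z Y A B : ℤ} (he : 0 ≤ e) (hY : 0 ≤ Y)
    (hYZ : Y ≤ Z) (hc : (e + 2) * (e + 1) + 1 ≤ 2 * s) (hB : 0 ≤ B) (hAB : B ≤ A)
    (hZ : 8 * s * (e + s + 3) ≤ Z) :
    (e + 2) * (e + 1) * ((Z + s + 2) * (Y + 1) * (A + B)) ≤
      2 * s * ((Z + 1) * (Z - e) * A + (Y + 1) * (Y - e) * B) := by
  have hs : 1 ≤ s := by nlinarith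
  have hs2 : 0 ≤ s * s := by positivity
  have hse : 0 ≤ s * e := by positivity
  have hZ0 : 24 ≤ Z := by nlinarith
  have hlin : 8 * s * (e + s + 3) * Z ≤ Z * Z := mul_le_mul_of_nonneg_right hZ (by linarith)
  -- replace `(e + 2) * (e + 1)` by `2 * s - 1`
  have h0 : (e + 2) * (e + 1) * ((Z + s + 2) * (Y + 1) * (A + B)) ≤
      (2 * s - 1) * ((Z + s + 2) * (Y + 1) * (A + B)) :=
    mul_le_mul_of_nonneg_right (by linarith)
      (mul_nonneg (mul_nonneg (by linarith) (by linarith)) (by linarith))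
  have hsZ : 0 ≤ s * Z := by positivity
  have hsY : s * Y ≤ s * Z := mul_le_mul_of_nonneg_left hYZ (by linarith)
  have hseZ : 0 ≤ s * e * Z := by positivity
  have hseY : s * e * Y ≤ s * e * Z := mul_le_mul_of_nonneg_left hYZ hse
  have hssZ : 0 ≤ s * s * Z := by positivity
  have hssY : s * s * Y ≤ s * s * Z := mul_le_mul_of_nonneg_left hYZ hs2
  have hseZ1 : s * e * 1 ≤ s * e * Z := mul_le_mul_of_nonneg_left (by linarith) hse
  have hssZ1 : s * s * 1 ≤ s * s * Z := mul_le_mul_of_nonneg_left (by linarith) hs2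
  have hsZ1 : s * 1 ≤ s * Z := mul_le_mul_of_nonneg_left (by linarith) (by linarith)
  have hZY : Z * Y ≤ Z * Z := mul_le_mul_of_nonneg_left hYZ (by linarith)
  have hsY0 : 0 ≤ s * Y := by positivity
  have hssY0 : 0 ≤ s * s * Y := by positivity
  have hcoefA : (2 * s - 1) * ((Z + s + 2) * (Y + 1)) ≤ 2 * s * ((Z + 1) * (Z - e)) := by
    have h1 : (2 * s - 1) * (Z * Y) ≤ (2 * s - 1) * (Z * Z) :=
      mul_le_mul_of_nonneg_left hZY (by linarith)
    linarith
  have hcoefB : (2 * s - 1) * ((Z + s + 2) * (Y + 1)) * 2 ≤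
      2 * s * ((Z + 1) * (Z - e) + (Y + 1) * (Y - e)) := by
    have h1 : 0 ≤ (2 * s - 1) * (Z - Y) ^ 2 := mul_nonneg (by linarith) (sq_nonneg _)
    have h2 : 0 ≤ Y * Y := by positivity
    linarith
  have hA' := mul_le_mul_of_nonneg_right hcoefA (sub_nonneg.2 hAB)
  have hB' := mul_le_mul_of_nonneg_right hcoefB hB
  linarith

/-- If `d (d - 1) < 2 s`, then, as long as the larger class is large, moving a vertex into it does
not increase the number of copies of `K_{s,s+d}`. -/
lemma bipartiteCopies_le_of_lt {s d x y : ℕ} (hs : 1 ≤ s) (hc : d * (d - 1) < 2 * s)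
    (hxy : y + 1 ≤ x) (hx : 8 * s * (d + s + 3) + s + 1 ≤ x) :
    bipartiteCopies s d (x + 1) y ≤ bipartiteCopies s d x (y + 1) := by
  obtain hd | hd := le_or_gt d 1
  · obtain h0 | h0 := Nat.eq_zero_or_pos (bipartiteCopies s d (x + 1) y)
    · omega
    · exact (bipartiteCopies_lt_of_le_one hs hd hxy h0).le
  obtain hys | hys := lt_or_ge y s
  · have h1 : y.descFactorial s = 0 := Nat.descFactorial_eq_zero_iff_lt.2 hys
    have h2 : y.descFactorial (s + d) = 0 := Nat.descFactorial_eq_zero_iff_lt.2 (by omega)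
    simp [bipartiteCopies, h1, h2]
  obtain ⟨e, rfl⟩ := Nat.exists_eq_add_of_le' hd
  obtain ⟨Y, rfl⟩ := Nat.exists_eq_add_of_le' hys
  obtain ⟨k, rfl⟩ : ∃ k, x = Y + k + 1 + s := ⟨x - (Y + 1 + s), by omega⟩
  have ht := Nat.descFactorial_trapezoid e Y k
  have hi1 := Nat.succ_descFactorial_succ_sub (Y + k + 1) (e + 1)
  have hi2 := Nat.succ_descFactorial_succ_sub Y (e + 1)
  have hX : (((Y + k + 1).descFactorial (e + 1 + 1) : ℕ) : ℤ) =
      (Y + k + 1) * (Y + k - e) * (Y + k).descFactorial e := by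
    rw [Nat.succ_descFactorial_succ]
    push_cast
    rw [Nat.cast_descFactorial_succ_int]
    push_cast; ring
  have hY : (((Y + 1).descFactorial (e + 1 + 1) : ℕ) : ℤ) =
      (Y + 1) * (Y - e) * Y.descFactorial e := by
    rw [Nat.succ_descFactorial_succ]
    push_cast
    rw [Nat.cast_descFactorial_succ_int]
    ring
  have hAB : ((Y.descFactorial e : ℕ) : ℤ) ≤ (Y + k).descFactorial e := by
    exact_mod_cast Nat.descFactorial_le e (Nat.le_add_right _ _)
  have hq := quadratic_bound (s := s) (e := e) (Z := Y + k) (Y := Y)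
    (A := (Y + k).descFactorial e) (B := Y.descFactorial e) (by positivity) (by positivity)
    (by linarith [(by positivity : (0 : ℤ) ≤ k)])
    (by
      have : (e + 2) * (e + 1) + 1 ≤ 2 * s := hc
      exact_mod_cast this)
    (by positivity) hAB
    (by
      have : 8 * s * (e + s + 3) ≤ Y + k := by nlinarith
      exact_mod_cast this)
  -- `ht` bounds the increment of the falling factorials, `hq` compares the result with `2 s`
  have hneg : (((Y + k + 1 : ℕ) : ℤ) + s + 1) * (Y + 1) *
        ((Y + k + 1 + 1).descFactorial (e + 1 + 1) + Y.descFactorial (e + 1 + 1)) -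
      ((Y + k + 1 : ℕ) + 1) * (Y + s + 1) *
        ((Y + k + 1).descFactorial (e + 1 + 1) + (Y + 1).descFactorial (e + 1 + 1)) ≤ 0 := by
    rw [← hX, ← hY] at hq
    push_cast at hi1 hi2 hq ht ⊢
    generalize (((Y + k + 1 + 1).descFactorial (e + 1 + 1) : ℕ) : ℤ) = u₁ at *
    generalize (((Y + k + 1).descFactorial (e + 1 + 1) : ℕ) : ℤ) = u₀ at *
    generalize (((Y + 1).descFactorial (e + 1 + 1) : ℕ) : ℤ) = v₁ at *
    generalize ((Y.descFactorial (e + 1 + 1) : ℕ) : ℤ) = v₀ at *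
    generalize (((Y + k + 1).descFactorial (e + 1) : ℕ) : ℤ) = u at *
    generalize ((Y.descFactorial (e + 1) : ℕ) : ℤ) = v at *
    generalize (((Y + k).descFactorial e : ℕ) : ℤ) = A at *
    generalize ((Y.descFactorial e : ℕ) : ℤ) = B at *
    obtain rfl : u₁ = u₀ + (e + 1 + 1) * u := by linarith
    obtain rfl : v₀ = v₁ - (e + 1 + 1) * v := by linarith
    have hT := mul_le_mul_of_nonneg_left ht
      (by positivity : (0 : ℤ) ≤ (Y + k + s + 2) * (Y + 1) * (e + 2))
    have hQ := mul_le_mul_of_nonneg_left hq (by positivity : (0 : ℤ) ≤ (k : ℤ) + 1)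
    linarith
  obtain ⟨p, q, hp, hq, hpq⟩ := bipartiteCopies_step s (e + 1 + 1) (Y + k + 1) Y
  by_contra! h
  have h' : (0 : ℤ) < bipartiteCopies s (e + 1 + 1) (Y + k + 1 + 1 + s) (Y + s) -
      bipartiteCopies s (e + 1 + 1) (Y + k + 1 + s) (Y + 1 + s) := by
    rw [show Y + k + 1 + s + 1 = Y + k + 1 + 1 + s by ring,
      show Y + s + 1 = Y + 1 + s by ring] at h
    rw [sub_pos]
    exact_mod_cast h
  have h1 := mul_pos hp h'
  rw [hpq] at h1
  exact absurd h1 (not_lt.2 (mul_nonpos_of_nonneg_of_nonpos hq.le hneg))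

/-- If `d (d - 1) ≥ 2 s`, moving a vertex out of one of two classes whose sizes differ by at most
one strictly increases the number of copies of `K_{s,s+d}`. -/
lemma bipartiteCopies_lt_of_ge {s d x y : ℕ} (hs : 1 ≤ s) (hc : 2 * s ≤ d * (d - 1))
    (hxy : x = y + 1 ∨ x = y + 2) (hy : s + d ≤ y) :
    bipartiteCopies s d x (y + 1) < bipartiteCopies s d (x + 1) y := by
  obtain hd | hd := le_or_gt d 1
  · interval_cases d <;> omega
  obtain ⟨e, rfl⟩ := Nat.exists_eq_add_of_le' hd
  obtain ⟨Y, rfl⟩ := Nat.exists_eq_add_of_le' (show s ≤ y by omega)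
  have hYe : e + 2 ≤ Y := by omega
  obtain ⟨k, hk, rfl⟩ : ∃ k, (k = 0 ∨ k = 1) ∧ x = Y + k + 1 + s :=
    ⟨x - (Y + 1 + s), by omega, by omega⟩
  have hi1 := Nat.succ_descFactorial_succ_sub (Y + k + 1) (e + 1)
  have hi2 := Nat.succ_descFactorial_succ_sub Y (e + 1)
  have hi3 := Nat.succ_descFactorial_succ_sub Y e
  have hi4 := Nat.succ_descFactorial_succ_sub (Y + 1) e
  have hX : (((Y + k + 1).descFactorial (e + 1 + 1) : ℕ) : ℤ) =
      (Y + k + 1) * (Y + k - e) * (Y + k).descFactorial e := by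
    rw [Nat.succ_descFactorial_succ]
    push_cast
    rw [Nat.cast_descFactorial_succ_int]
    push_cast; ring
  have hY : (((Y + 1).descFactorial (e + 1 + 1) : ℕ) : ℤ) =
      (Y + 1) * (Y - e) * Y.descFactorial e := by
    rw [Nat.succ_descFactorial_succ]
    push_cast
    rw [Nat.cast_descFactorial_succ_int]
    ring
  have hA : ((Y : ℤ) + 1 - e) * (Y + 1).descFactorial e = (Y + 1) * Y.descFactorial e := by
    have h1 := Nat.cast_descFactorial_succ_int (Y + 1) e
    rw [Nat.succ_descFactorial_succ] at h1
    push_cast at h1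
    exact h1.symm
  have hBpos : (0 : ℤ) < Y.descFactorial e := by
    exact_mod_cast Nat.descFactorial_pos.2 (by omega)
  have hApos : (0 : ℤ) < (Y + 1).descFactorial e := by
    exact_mod_cast Nat.descFactorial_pos.2 (by omega)
  have hc' : 2 * (s : ℤ) ≤ (e + 2) * (e + 1) := by
    have : 2 * s ≤ (e + 2) * (e + 1) := hc
    exact_mod_cast this
  have hs' : (1 : ℤ) ≤ s := by exact_mod_cast hs
  have he' : (0 : ℤ) ≤ e := by positivity
  have hYe' : (e : ℤ) + 2 ≤ Y := by exact_mod_cast hYe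
  have hpos : 0 < (((Y + k + 1 : ℕ) : ℤ) + s + 1) * (Y + 1) *
        ((Y + k + 1 + 1).descFactorial (e + 1 + 1) + Y.descFactorial (e + 1 + 1)) -
      ((Y + k + 1 : ℕ) + 1) * (Y + s + 1) *
        ((Y + k + 1).descFactorial (e + 1 + 1) + (Y + 1).descFactorial (e + 1 + 1)) := by
    -- equal classes, and classes differing by one: the trapezoid rule is an identity
    obtain rfl | rfl := hk
    · simp only [add_zero, Nat.cast_zero] at hi1 hX ⊢
      push_cast at hi1 hi2 hi3 ⊢
      rw [eq_add_of_sub_eq hi1]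
      rw [show ((Y.descFactorial (e + 1 + 1) : ℕ) : ℤ) = (Y + 1).descFactorial (e + 1 + 1) -
        (e + 1 + 1) * Y.descFactorial (e + 1) by linarith, eq_add_of_sub_eq hi3, hY]
      have h1 : 2 * (s : ℤ) * ((Y + 1) * (Y - e) * Y.descFactorial e) <
          (e + 2) * (e + 1) * ((Y + s + 2) * (Y + 1) * Y.descFactorial e) := by
        refine lt_of_lt_of_le (mul_lt_mul_of_pos_left ?_ (by linarith))
          (mul_le_mul_of_nonneg_right hc' (by positivity))
        refine mul_lt_mul_of_pos_right ?_ hBpos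
        rw [mul_comm]
        exact mul_lt_mul_of_pos_right (by linarith) (by positivity)
      linarith
    · push_cast at hi1 hi2 hi3 hi4 hX ⊢
      rw [eq_add_of_sub_eq hi1]
      rw [show ((Y.descFactorial (e + 1 + 1) : ℕ) : ℤ) = (Y + 1).descFactorial (e + 1 + 1) -
        (e + 1 + 1) * Y.descFactorial (e + 1) by linarith, eq_add_of_sub_eq hi4,
        eq_add_of_sub_eq hi3, hX, hY]
      generalize (((Y + 1).descFactorial e : ℕ) : ℤ) = A at *
      generalize ((Y.descFactorial e : ℕ) : ℤ) = B at *
      have h1 : 2 * (s : ℤ) * ((Y + 1 - e) * (Y + 1) * (A + B)) <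
          (e + 2) * (e + 1) * ((Y + s + 3) * (Y + 1) * (A + B)) := by
        refine lt_of_lt_of_le (mul_lt_mul_of_pos_left ?_ (by linarith))
          (mul_le_mul_of_nonneg_right hc' (by positivity))
        gcongr
        linarith
      have h2 : (s : ℤ) * (Y + 2) * ((Y + 1 - e) * A) = s * (Y + 2) * ((Y + 1) * B) := by
        rw [hA]
      have h3 : (s : ℤ) * (Y + 1) * ((Y + 1 - e) * A) = s * (Y + 1) * ((Y + 1) * B) := by
        rw [hA]
      linarith
  obtain ⟨p, q, hp, hq, hpq⟩ := bipartiteCopies_step s (e + 1 + 1) (Y + k + 1) Y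
  by_contra! h
  have h' : (bipartiteCopies s (e + 1 + 1) (Y + k + 1 + 1 + s) (Y + s) : ℤ) -
      bipartiteCopies s (e + 1 + 1) (Y + k + 1 + s) (Y + 1 + s) ≤ 0 := by
    rw [show Y + k + 1 + s + 1 = Y + k + 1 + 1 + s by ring,
      show Y + s + 1 = Y + 1 + s by ring] at h
    rw [sub_nonpos]
    exact_mod_cast h
  have h1 := mul_nonpos_of_nonneg_of_nonpos hp.le h'
  rw [hpq] at h1
  exact absurd (mul_pos hq hpos) (not_lt.2 h1)

end TwoParts

end SimpleGraph

/-! ### Balanced patterns and the Turán graph -/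

namespace SimpleGraph

open Finset Function

section Balancing

variable {V : Type*} [Fintype V] [DecidableEq V] {r : ℕ} {a : Fin r → ℕ}

/-- For a balanced pattern, moving a vertex `v` from a class to one that is smaller by at least two
strictly increases the number of copies. The terms for `σ` and `σ` followed by the transposition
of the two classes add up to a `bipartiteCopies` count times a common factor. -/
lemma labelledCopyCount_lt_of_add_two_le (ha : ∀ i, 1 ≤ a i) (hbal : ∀ i j, a i ≤ a j + 1)
    (c : V → Fin r) {v : V} {j : Fin r} (h : #{x | c x = j} + 2 ≤ #{x | c x = c v})
    (hpos : 0 < ((⊤ : SimpleGraph (Fin r)).comap c).labelledCopyCount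
      (completeMultipartiteGraph fun i => Fin (a i))) :
    ((⊤ : SimpleGraph (Fin r)).comap c).labelledCopyCount
        (completeMultipartiteGraph fun i => Fin (a i)) <
      ((⊤ : SimpleGraph (Fin r)).comap (update c v j)).labelledCopyCount
        (completeMultipartiteGraph fun i => Fin (a i)) := by
  classical
  set i := c v with hi
  have hij : i ≠ j := by
    rintro hij
    rw [hij] at h
    omega
  have key := labelledCopyCount_comap_top (V := V) ha
  -- reindex by `σ⁻¹`, so that the product runs over the classes
  have reidx : ∀ N : Fin r → ℕ, ∑ σ : Equiv.Perm (Fin r), ∏ k, (N (σ k)).descFactorial (a k) =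
      ∑ σ : Equiv.Perm (Fin r), ∏ k, (N k).descFactorial (a (σ k)) := by
    intro N
    rw [← Equiv.sum_comp (Equiv.inv (Equiv.Perm (Fin r)))]
    refine sum_congr rfl fun σ _ => ?_
    rw [← Equiv.prod_comp σ]
    simp
  have dbl : ∀ N : Fin r → ℕ, 2 * ∑ σ : Equiv.Perm (Fin r), ∏ k, (N (σ k)).descFactorial (a k) =
      ∑ σ : Equiv.Perm (Fin r), (∏ k ∈ (univ.erase i).erase j, (N k).descFactorial (a (σ k))) *
        ((N i).descFactorial (a (σ i)) * (N j).descFactorial (a (σ j)) +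
          (N i).descFactorial (a (σ j)) * (N j).descFactorial (a (σ i))) := by
    intro N
    rw [reidx, two_mul]
    nth_rewrite 2 [← Equiv.sum_comp (Equiv.mulRight (Equiv.swap i j))]
    rw [← sum_add_distrib]
    refine sum_congr rfl fun σ _ => ?_
    have hj : j ∈ (univ : Finset (Fin r)).erase i := by simp [hij.symm]
    rw [← mul_prod_erase univ _ (mem_univ i), ← mul_prod_erase _ _ hj,
      ← mul_prod_erase univ _ (mem_univ i), ← mul_prod_erase _ _ hj]
    have : ∏ k ∈ (univ.erase i).erase j,
        (N k).descFactorial (a ((Equiv.mulRight (Equiv.swap i j)) σ k)) =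
        ∏ k ∈ (univ.erase i).erase j, (N k).descFactorial (a (σ k)) := by
      refine prod_congr rfl fun k hk => ?_
      simp only [mem_erase, mem_univ, and_true] at hk
      simp [Equiv.swap_apply_of_ne_of_ne hk.2 hk.1]
    rw [this]
    simp only [Equiv.coe_mulRight, Equiv.Perm.coe_mul, comp_apply, Equiv.swap_apply_left,
      Equiv.swap_apply_right]
    ring
  set N : Fin r → ℕ := fun k => #{x | c x = k} with hN
  set N' : Fin r → ℕ := fun k => #{x | update c v j x = k} with hN'
  have hNi : N i = N' i + 1 := by
    have : (univ.filter fun x => c x = i) = insert v (univ.filter fun x => update c v j x = i) := by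
      ext x
      by_cases hx : x = v
      · subst hx; simp [hi]
      · simp [hx]
    simp only [hN, hN']
    rw [this, card_insert_of_notMem (by simp [hij.symm])]
  have hNj : N' j = N j + 1 := by
    have : (univ.filter fun x => update c v j x = j) = insert v (univ.filter fun x => c x = j) := by
      ext x
      by_cases hx : x = v
      · subst hx; simp
      · simp [hx]
    simp only [hN, hN']
    rw [this, card_insert_of_notMem (by simp [← hi, hij])]
  have hNk : ∀ k, k ≠ i → k ≠ j → N' k = N k := by
    intro k hki hkj
    simp only [hN, hN']
    congr 1
    ext x
    by_cases hx : x = v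
    · subst hx; simp [← hi, hki.symm, hkj.symm]
    · simp [hx]
  have hle : N j + 1 ≤ N' i := by
    have : N j + 2 ≤ N i := h
    omega
  -- the two-class comparison, for either order of the two part sizes
  have step : ∀ p q, 1 ≤ p → 1 ≤ q → p ≤ q + 1 → q ≤ p + 1 →
      0 < (N i).descFactorial p * (N j).descFactorial q +
        (N i).descFactorial q * (N j).descFactorial p →
      (N i).descFactorial p * (N j).descFactorial q +
        (N i).descFactorial q * (N j).descFactorial p <
      (N' i).descFactorial p * (N' j).descFactorial q +
        (N' i).descFactorial q * (N' j).descFactorial p := by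
    intro p q hp hq hpq hqp hpos
    wlog hle' : p ≤ q generalizing p q
    · have := this q p hq hp hqp hpq (by rwa [add_comm]) (by omega)
      rwa [add_comm, add_comm ((N' i).descFactorial p * _)]
    obtain ⟨d, rfl⟩ := Nat.exists_eq_add_of_le hle'
    rw [hNi, hNj] at *
    exact bipartiteCopies_lt_of_le_one hp (by omega) hle hpos
  rw [key] at hpos
  rw [key, key]
  refine Nat.lt_of_mul_lt_mul_left (a := 2) ?_
  have hpos2 : 0 < 2 * ∑ σ : Equiv.Perm (Fin r), ∏ k, (N (σ k)).descFactorial (a k) :=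
    Nat.mul_pos two_pos hpos
  change 2 * ∑ σ : Equiv.Perm (Fin r), ∏ k, (N (σ k)).descFactorial (a k) <
    2 * ∑ σ : Equiv.Perm (Fin r), ∏ k, (N' (σ k)).descFactorial (a k)
  rw [dbl] at hpos2
  rw [dbl, dbl]
  have hprod : ∀ σ : Equiv.Perm (Fin r),
      ∏ k ∈ (univ.erase i).erase j, (N' k).descFactorial (a (σ k)) =
        ∏ k ∈ (univ.erase i).erase j, (N k).descFactorial (a (σ k)) := by
    intro σ
    refine prod_congr rfl fun k hk => ?_
    simp only [mem_erase, mem_univ, and_true] at hk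
    rw [hNk k hk.2 hk.1]
  simp only [hprod]
  refine sum_lt_sum (fun σ _ => Nat.mul_le_mul_left _ ?_) ?_
  · obtain h0 | h0 := Nat.eq_zero_or_pos ((N i).descFactorial (a (σ i)) *
      (N j).descFactorial (a (σ j)) + (N i).descFactorial (a (σ j)) *
        (N j).descFactorial (a (σ i)))
    · rw [h0]; exact Nat.zero_le _
    · exact (step _ _ (ha _) (ha _) (hbal _ _) (hbal _ _) h0).le
  · obtain ⟨σ, hσ, h0⟩ := exists_ne_zero_of_sum_ne_zero hpos2.ne'
    refine ⟨σ, hσ, ?_⟩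
    have h1 := Nat.pos_of_ne_zero (left_ne_zero_of_mul h0)
    have h2 := Nat.pos_of_ne_zero (right_ne_zero_of_mul h0)
    exact Nat.mul_lt_mul_of_pos_left (step _ _ (ha _) (ha _) (hbal _ _) (hbal _ _) h2) h1

end Balancing

section TuranGraph

/-- A complete `r`-partite graph with non-empty classes of nearly equal sizes is a Turán graph. -/
lemma nonempty_iso_turanGraph_of_equitable {n r : ℕ} {c : Fin n → Fin r} (hc : Surjective c)
    (hbal : ∀ i j, #{x | c x = i} ≤ #{x | c x = j} + 1) :
    Nonempty ((⊤ : SimpleGraph (Fin r)).comap c ≃g turanGraph n r) := by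
  classical
  let P : Finpartition (univ : Finset (Fin n)) := Finpartition.ofSetoid (Setoid.ker c)
  have hpart : ∀ x, P.part x = ({y | c y = c x} : Finset (Fin n)) := by
    intro x
    ext y
    simp only [P, Finpartition.mem_part_ofSetoid_iff_rel, Setoid.ker_def, mem_filter, mem_univ,
      true_and]
    exact eq_comm
  have hparts : P.parts = univ.image fun i => ({y | c y = i} : Finset (Fin n)) := by
    ext p
    simp only [mem_image, mem_univ, true_and]
    constructor
    · intro hp
      obtain ⟨x, hx⟩ := P.nonempty_of_mem_parts hp
      exact ⟨c x, by rw [← hpart x, P.part_eq_of_mem hp hx]⟩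
    · rintro ⟨i, rfl⟩
      obtain ⟨x, rfl⟩ := hc i
      rw [← hpart x]
      exact P.part_mem.2 (mem_univ x)
  have hcard : #P.parts = r := by
    rw [hparts, card_image_of_injective, card_univ, Fintype.card_fin]
    intro i j hij
    obtain ⟨x, rfl⟩ := hc i
    have : x ∈ ({y | c y = c x} : Finset (Fin n)) := by simp
    rw [show ({y | c y = c x} : Finset (Fin n)) = ({y | c y = j} : Finset (Fin n)) from hij] at this
    simpa using this
  have hP : P.IsEquipartition := by
    by_contra hP
    rw [Finpartition.not_isEquipartition] at hP
    obtain ⟨p, hp, q, hq, hpq⟩ := hP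
    rw [hparts] at hp hq
    obtain ⟨i, -, rfl⟩ := mem_image.1 hp
    obtain ⟨j, -, rfl⟩ := mem_image.1 hq
    have := hbal i j
    omega
  obtain ⟨f, hf⟩ := hP.exists_partPreservingEquiv
  have hcn : #(univ : Finset (Fin n)) = n := by simp
  let g : Fin n ≃ Fin n :=
    (Equiv.subtypeUnivEquiv (fun x => mem_univ x)).symm.trans (f.trans (finCongr hcn))
  refine ⟨⟨g, fun {x y} => ?_⟩⟩
  have h1 := hf ⟨x, mem_univ x⟩ ⟨y, mem_univ y⟩
  have h2 : P.part x = P.part y ↔ c x = c y := by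
    rw [← P.mem_part_iff_part_eq_part (mem_univ _) (mem_univ _), hpart]
    simp
  simp only [hcard] at h1
  rw [turanGraph_adj, comap_adj, top_adj, ne_eq, ne_eq, not_iff_not, ← h2]
  exact h1.symm

lemma turanGraph_eq_comap_top {n r : ℕ} (hr : 0 < r) :
    turanGraph n r = (⊤ : SimpleGraph (Fin r)).comap
      fun x : Fin n => ⟨x % r, Nat.mod_lt _ hr⟩ := by
  ext x y
  simp [turanGraph_adj, Fin.ext_iff]

/-- For a balanced complete `r`-partite pattern every maximizer is a Turán graph. -/
lemma MaximizesLabelledCopies.nonempty_iso_turanGraph {n r : ℕ} {a : Fin r → ℕ} (hr : 1 ≤ r)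
    (ha : ∀ i, 1 ≤ a i) (hbal : ∀ i j, a i ≤ a j + 1) (hn : ∑ i, a i ≤ n)
    {G : SimpleGraph (Fin n)}
    (hG : MaximizesLabelledCopies (completeMultipartiteGraph fun i => Fin (a i)) (r + 1) G) :
    Nonempty (G ≃g turanGraph n r) := by
  obtain ⟨c₀, hc₀⟩ := exists_comap_top_isContained (V := Fin n) (a := a) (by simpa using hn) hr
  obtain ⟨c, hc, rfl⟩ := hG.exists_eq_comap_top (completeMultipartiteGraph.isCompleteMultipartite _)
    (completeMultipartiteGraph_not_cliqueFree ha) (comap_top_cliqueFree c₀) hc₀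
  refine nonempty_iso_turanGraph_of_equitable hc fun i j => ?_
  by_contra! hij
  obtain ⟨v, rfl⟩ := hc i
  exact absurd (hG.2 _ (comap_top_cliqueFree (update c v j)))
    (not_le.2 (labelledCopyCount_lt_of_add_two_le ha hbal c hij
      ((labelledCopyCount_pos.2 hc₀).trans_le (hG.2 _ (comap_top_cliqueFree c₀)))))

theorem uniquelyMaximizesCopies_turanGraph {n r : ℕ} {a : Fin r → ℕ} (hr : 1 ≤ r)
    (ha : ∀ i, 1 ≤ a i) (hbal : ∀ i j, a i ≤ a j + 1) (hn : ∑ i, a i ≤ n) :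
    UniquelyMaximizesCopies (completeMultipartiteGraph fun i : Fin r => Fin (a i)) (r + 1)
      (turanGraph n r) := by
  obtain ⟨G, hG⟩ := exists_maximizesLabelledCopies
    (completeMultipartiteGraph fun i : Fin r => Fin (a i)) (turanGraph_cliqueFree (n := n) hr)
  obtain ⟨e⟩ := hG.nonempty_iso_turanGraph hr ha hbal hn
  refine ⟨maximizesCopies_iff.2 ⟨turanGraph_cliqueFree hr, fun G' hG' => ?_⟩, fun G' hG' => ?_⟩
  · rw [← labelledCopyCount_congr_right _ e]
    exact hG.2 G' hG'
  · exact (maximizesCopies_iff.1 hG').nonempty_iso_turanGraph hr ha hbal hn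

end TuranGraph

end SimpleGraph

/-! ### Complete bipartite patterns -/

namespace SimpleGraph

open Finset Function

section Bipartite

/-- The bipartite pattern as a two-part complete multipartite graph. -/
noncomputable def completeBipartiteGraphIso (s t : ℕ) :
    completeBipartiteGraph (Fin s) (Fin t) ≃g
      completeMultipartiteGraph fun i : Fin 2 => Fin (![s, t] i) where
  toEquiv := Equiv.ofBijective
    (Sum.elim (fun k => ⟨0, k⟩) fun l => ⟨1, l⟩) (by
      constructor
      · rintro (k | k) (l | l) h
        · exact congrArg Sum.inl (eq_of_heq (Sigma.mk.inj h).2)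
        · exact absurd (congrArg Sigma.fst h) (zero_ne_one (α := Fin 2))
        · exact absurd (congrArg Sigma.fst h) (one_ne_zero (α := Fin 2))
        · exact congrArg Sum.inr (eq_of_heq (Sigma.mk.inj h).2)
      · rintro ⟨i, k⟩
        fin_cases i
        · exact ⟨Sum.inl k, rfl⟩
        · exact ⟨Sum.inr k, rfl⟩)
  map_rel_iff' := by
    rintro (k | k) (l | l)
    · change (0 : Fin 2) ≠ 0 ↔ _; simp
    · change (0 : Fin 2) ≠ 1 ↔ _; simp
    · change (1 : Fin 2) ≠ 0 ↔ _; simp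
    · change (1 : Fin 2) ≠ 1 ↔ _; simp

lemma labelledCopyCount_comap_top_two {V : Type*} [Fintype V] {s d : ℕ} (hs : 1 ≤ s)
    (c : V → Fin 2) :
    ((⊤ : SimpleGraph (Fin 2)).comap c).labelledCopyCount
        (completeMultipartiteGraph fun i : Fin 2 => Fin (![s, s + d] i)) =
      bipartiteCopies s d #{v | c v = 0} #{v | c v = 1} := by
  rw [labelledCopyCount_comap_top (a := ![s, s + d])
    (by simp [Fin.forall_fin_two]; omega)]
  generalize hN : (fun i => #{v | c v = i}) = N
  change ∑ σ : Equiv.Perm (Fin 2), ∏ i, ((fun i => #{v | c v = i}) (σ i)).descFactorial _ =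
    bipartiteCopies s d ((fun i => #{v | c v = i}) 0) ((fun i => #{v | c v = i}) 1)
  rw [hN]
  have huniv : (univ : Finset (Equiv.Perm (Fin 2))) = {1, Equiv.swap 0 1} := by decide
  rw [huniv, sum_pair (by decide)]
  simp [Fin.prod_univ_two, bipartiteCopies]
  ring

lemma card_filter_zero_add_card_filter_one {V : Type*} [Fintype V] (c : V → Fin 2) :
    #{v | c v = 0} + #{v | c v = 1} = Fintype.card V := by
  have h := card_filter_add_card_filter_not (s := (univ : Finset V)) (fun v => c v = 0)
  rw [card_univ] at h
  rw [← h]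
  congr 2
  ext v
  simp only [mem_filter, mem_univ, true_and]
  omega

lemma card_filter_mod_two_eq_zero (n : ℕ) : #{x : Fin n | (x : ℕ) % 2 = 0} = (n + 1) / 2 := by
  induction n with
  | zero => simp
  | succ n ih =>
    rw [card_filter] at ih ⊢
    rw [Fin.sum_univ_castSucc]
    simp only [Fin.val_castSucc, Fin.val_last]
    rw [ih]
    split_ifs <;> omega

lemma labelledCopyCount_turanGraph_two {s d : ℕ} (hs : 1 ≤ s) (n : ℕ) :
    (turanGraph n 2).labelledCopyCount
        (completeMultipartiteGraph fun i : Fin 2 => Fin (![s, s + d] i)) =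
      bipartiteCopies s d ((n + 1) / 2) (n / 2) := by
  rw [turanGraph_eq_comap_top two_pos, labelledCopyCount_comap_top_two hs]
  have h := card_filter_zero_add_card_filter_one
    fun x : Fin n => (⟨x % 2, Nat.mod_lt _ two_pos⟩ : Fin 2)
  have h0 : #{x : Fin n | (⟨x % 2, Nat.mod_lt _ two_pos⟩ : Fin 2) = 0} = (n + 1) / 2 := by
    rw [← card_filter_mod_two_eq_zero n]
    congr 1
    ext x
    simp [Fin.ext_iff]
  rw [Fintype.card_fin] at h
  rw [h0] at h ⊢
  congr 1
  omega

/-- Below the threshold, the balanced bipartition is optimal among all bipartitions. -/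
lemma bipartiteCopies_le_balanced {s d n x y : ℕ} (hs : 1 ≤ s) (hc : d * (d - 1) < 2 * s)
    (hn : 2 * (8 * s * (d + s + 3) + s + 1) + 2 ≤ n) (hxy : x + y = n) :
    bipartiteCopies s d x y ≤ bipartiteCopies s d ((n + 1) / 2) (n / 2) := by
  wlog hyx : y ≤ x generalizing x y
  · rw [bipartiteCopies_comm]
    exact this (by omega) (by omega)
  obtain ⟨k, hk⟩ : ∃ k, x = (n + 1) / 2 + k := ⟨x - (n + 1) / 2, by omega⟩
  induction k generalizing x y with
  | zero =>
    obtain rfl : x = (n + 1) / 2 := hk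
    obtain rfl : y = n / 2 := by omega
    exact le_rfl
  | succ k ih =>
    obtain rfl : x = (n + 1) / 2 + k + 1 := hk
    exact (bipartiteCopies_le_of_lt hs hc (by omega) (by omega)).trans
      (ih (by omega) (by omega) rfl)

lemma exists_card_filter_eq {n x : ℕ} (hx : x ≤ n) : ∃ c : Fin n → Fin 2,
    #{v | c v = 0} = x ∧ #{v | c v = 1} = n - x := by
  let c : Fin n → Fin 2 := fun v => if (v : ℕ) < x then 0 else 1
  have h := card_filter_zero_add_card_filter_one c
  have h0 : #{v | c v = 0} = x := by
    have : (univ.filter fun v => c v = 0) = univ.filter fun v : Fin n => (v : ℕ) < x := by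
      ext v
      simp [c]
    rw [this, Fin.card_filter_val_lt]
    simpa using hx
  rw [Fintype.card_fin] at h
  exact ⟨c, h0, by omega⟩

theorem maximizesLabelledCopies_turanGraph_two_iff {s d n : ℕ} (hs : 1 ≤ s)
    (hn : 2 * (8 * s * (d + s + 3) + s + d + 2) + 2 ≤ n) :
    MaximizesLabelledCopies (completeMultipartiteGraph fun i : Fin 2 => Fin (![s, s + d] i)) 3
      (turanGraph n 2) ↔ d * (d - 1) < 2 * s := by
  have ha : ∀ i, 1 ≤ ![s, s + d] i := by
    simp [Fin.forall_fin_two]; omega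
  constructor
  · intro h
    by_contra! hc
    obtain ⟨c, hc0, hc1⟩ := exists_card_filter_eq (n := n) (x := (n + 1) / 2 + 1) (by omega)
    have h1 := h.2 _ (comap_top_cliqueFree c)
    rw [labelledCopyCount_turanGraph_two hs, labelledCopyCount_comap_top_two hs, hc0, hc1] at h1
    have h2 := bipartiteCopies_lt_of_ge (x := (n + 1) / 2) (y := n / 2 - 1) hs hc (by omega)
      (by
        have : s + d + 2 ≤ 8 * s * (d + s + 3) + s + d + 2 := by omega
        omega)
    rw [show n / 2 - 1 + 1 = n / 2 by omega] at h2
    rw [show n - ((n + 1) / 2 + 1) = n / 2 - 1 by omega] at h1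
    omega
  · intro hc
    refine ⟨turanGraph_cliqueFree two_pos, ?_⟩
    obtain ⟨G, hG⟩ := exists_maximizesLabelledCopies
      (completeMultipartiteGraph fun i : Fin 2 => Fin (![s, s + d] i))
      (turanGraph_cliqueFree (n := n) two_pos)
    obtain ⟨c₀, hc₀⟩ := exists_comap_top_isContained (V := Fin n) (a := ![s, s + d])
      (by
        simp only [Fin.sum_univ_two, Fintype.card_fin]
        have : s ≤ 8 * s * (d + s + 3) := by nlinarith
        simp
        omega) one_le_two
    obtain ⟨c, -, rfl⟩ := hG.exists_eq_comap_top
      (completeMultipartiteGraph.isCompleteMultipartite _)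
      (completeMultipartiteGraph_not_cliqueFree ha) (comap_top_cliqueFree c₀) hc₀
    intro G' hG'
    refine (hG.2 G' hG').trans ?_
    rw [labelledCopyCount_turanGraph_two hs, labelledCopyCount_comap_top_two hs]
    exact bipartiteCopies_le_balanced hs hc (by omega)
      ((card_filter_zero_add_card_filter_one c).trans (by simp))

end Bipartite

/-- The threshold on `t = s + d` in integral form. -/
lemma cast_lt_add_sqrt_iff (s d : ℕ) (hs : 1 ≤ s) :
    ((s + d : ℕ) : ℝ) < (s : ℝ) + 1 / 2 + Real.sqrt (2 * (s : ℝ) + 1 / 4) ↔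
      d * (d - 1) < 2 * s := by
  have h1 : ((s + d : ℕ) : ℝ) < (s : ℝ) + 1 / 2 + Real.sqrt (2 * (s : ℝ) + 1 / 4) ↔
      (d : ℝ) - 1 / 2 < Real.sqrt (2 * (s : ℝ) + 1 / 4) := by
    push_cast
    constructor <;> intro h <;> linarith
  rw [h1]
  obtain rfl | ⟨e, rfl⟩ : d = 0 ∨ ∃ e, d = e + 1 := by
    cases d <;> simp
  · have := Real.sqrt_nonneg (2 * (s : ℝ) + 1 / 4)
    simp only [zero_mul, Nat.cast_zero]
    exact ⟨fun _ => by omega, fun _ => by linarith⟩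
  · rw [Real.lt_sqrt (by push_cast; linarith [(Nat.cast_nonneg e : (0 : ℝ) ≤ e)])]
    rw [Nat.add_sub_cancel, ← Nat.cast_lt (α := ℝ)]
    push_cast
    constructor <;> intro h <;> nlinarith

end SimpleGraph

theorem theorem1p5 :
    (∀ (r : ℕ) (a : Fin r → ℕ), 1 ≤ r → (∀ i, 1 ≤ a i) → (∀ i j, a i ≤ a j + 1) →
      ∃ n₀ : ℕ, ∀ n : ℕ, n₀ ≤ n →
        UniquelyMaximizesCopies
          (SimpleGraph.completeMultipartiteGraph (fun i : Fin r => Fin (a i))) (r + 1)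
          (SimpleGraph.turanGraph n r)) ∧
    (∀ s t : ℕ, 1 ≤ s → s ≤ t →
      ∃ n₀ : ℕ, ∀ n : ℕ, n₀ ≤ n →
        (MaximizesCopies (completeBipartiteGraph (Fin s) (Fin t)) 3
            (SimpleGraph.turanGraph n 2) ↔
          (t : ℝ) < (s : ℝ) + 1 / 2 + Real.sqrt (2 * (s : ℝ) + 1 / 4))) := by
  refine ⟨fun r a hr ha hbal => ⟨∑ i, a i, fun n hn =>
    SimpleGraph.uniquelyMaximizesCopies_turanGraph hr ha hbal hn⟩, fun s t hs hst => ?_⟩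
  obtain ⟨d, rfl⟩ := Nat.exists_eq_add_of_le hst
  refine ⟨2 * (8 * s * (d + s + 3) + s + d + 2) + 2, fun n hn => ?_⟩
  rw [SimpleGraph.cast_lt_add_sqrt_iff s d hs,
    ← SimpleGraph.maximizesLabelledCopies_turanGraph_two_iff hs hn,
    ← SimpleGraph.maximizesCopies_iff]
  simp only [MaximizesCopies, SimpleGraph.copyCount_congr_left _
    (SimpleGraph.completeBipartiteGraphIso s (s + d))]
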